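/- Let $\mathbb F$ be a field and $V$ a vector space over $\mathbb F$ of finite positive dimension. A Leonard pair on $V$ is an ordered pair $A,A^*$ of $\mathbb F$-linear maps $V\to V$ such that (i) for some basis of $V$ the matrix of $A$ is irreducible tridiagonal and the matrix of $A^*$ is diagonal, and (ii) for some basis of $V$ the matrix of $A^*$ is irreducible tridiagonal and the matrix of $A$ is diagonal. (A tridiagonal matrix is irreducible if all its entries on the subdiagonal and the superdiagonal are nonzero.) In a Leonard pair, each of $A,A^*$ is diagonalizable with one-dimensional eigenspaces; the primitive idempotent of $A$ for an eigenvalue $\theta$ is the projection of $V$ onto the $\theta$-eigenspace along the sum of the other eigenspaces, and likewise for $A^*$. An ordering $\{E_i\}_{i=0}^d$ of the primitive idempotents of $A$ is standard if, for nonzero $v_i\in E_iV$, the basis $\{v_i\}_{i=0}^d$ is as in (ii); an ordering $\{E^*_i\}_{i=0}^d$ of the primitive idempotents of $A^*$ is standard if, for nonzero $v_i\in E^*_iV$, the basis $\{v_i\}_{i=0}^d$ is as in (i). A Leonard system on $V$ is a sequence $\Phi=(A;\{E_i\}_{i=0}^d;A^*;\{E^*_i\}_{i=0}^d)$ where $A,A^*$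 is a Leonard pair on $V$ and $\{E_i\}_{i=0}^d$, $\{E^*_i\}_{i=0}^d$ are standard orderings of the primitive idempotents of $A$ and of $A^*$. Then $\Phi^*=(A^*;\{E^*_i\}_{i=0}^d;A;\{E_i\}_{i=0}^d)$ is also a Leonard system. $\Phi$ is called self-dual if there is an $\mathbb F$-algebra automorphism $\sigma$ of $\mathrm{End}(V)$ with $\sigma(A)=A^*$, $\sigma(A^*)=A$, $\sigma(E_i)=E^*_i$ and $\sigma(E^*_i)=E_i$ for $0\le i\le d$; such a $\sigma$ is called the duality $\Phi\leftrightarrow\Phi^*$. Let $\theta_i$ (resp. $\theta^*_i$) be the eigenvalue of $A$ (resp. $A^*$) corresponding to $E_i$ (resp. $E^*_i$), and for $0\le i\le d$ put $$\tau_i=\prod_{j=0}^{i-1}(x-\theta_j),\quad \eta_i=\prod_{j=0}^{i-1}(x-\theta_{d-j}),\quad \tau^*_i=\prod_{j=0}^{i-1}(x-\theta^*_j),\quad \eta^*_i=\prod_{j=0}^{i-1}(x-\theta^*_{d-j}).$$ Define $$T=\sum_{i=0}^d \eta_{d-i}(A)\,E^*_0E_d\,\tau^*_i(A^*),\qquad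 T^*=\sum_{i=0}^d \eta^*_{d-i}(A^*)\,E_0E^*_d\,\tau_i(A).$$ Theorem 8.2. Assume that the Leonard system $\Phi$ is self-dual. Then there is a unique antiautomorphism $\dagger$ of the $\mathbb F$-algebra $\mathrm{End}(V)$ (an $\mathbb F$-linear bijection with $(XY)^\dagger=Y^\dagger X^\dagger$) that fixes $A$ and $A^*$, there is a unique $\mathbb F$-algebra automorphism $\sigma$ of $\mathrm{End}(V)$ that swaps $A$ and $A^*$, and $\sigma$ is the duality $\Phi\leftrightarrow\Phi^*$. Moreover $$T=T^*=T^\dagger=(T^*)^\dagger,$$ this common element $T$ is invertible, and $\sigma(X)=TXT^{-1}$ for all $X\in\mathrm{End}(V)$. -/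

import Mathlib

open Polynomial Module

namespace Leonard

section Matrices

variable {F : Type*} [Field F]

/-- Every nonzero entry lies on the diagonal, the subdiagonal or the superdiagonal. -/
def IsTridiagonal {n : ℕ} (M : Matrix (Fin n) (Fin n) F) : Prop :=
  ∀ i j : Fin n, M i j ≠ 0 → (i : ℕ) ≤ j + 1 ∧ (j : ℕ) ≤ i + 1

/-- Tridiagonal, with all entries on the superdiagonal and on the subdiagonal nonzero. -/
def IsIrreducibleTridiagonal {n : ℕ} (M : Matrix (Fin n) (Fin n) F) : Prop :=
  IsTridiagonal M ∧ ∀ i j : Fin n, (i : ℕ) + 1 = j → M i j ≠ 0 ∧ M j i ≠ 0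

end Matrices

section Pairs

variable {F V : Type*} [Field F] [AddCommGroup V] [Module F V]

/-- With respect to the basis `b`, the matrix of `X` is irreducible tridiagonal and the matrix
of `Y` is diagonal. -/
def IsTridiagonalDiagonalBasis {n : ℕ} (b : Basis (Fin n) F V) (X Y : End F V) : Prop :=
  IsIrreducibleTridiagonal (LinearMap.toMatrix b b X) ∧ (LinearMap.toMatrix b b Y).IsDiag

/-- `A, B` is a Leonard pair on `V`. -/
def IsLeonardPair (A B : End F V) : Prop :=
  (∃ (n : ℕ) (b : Basis (Fin n) F V), IsTridiagonalDiagonalBasis b A B) ∧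
  (∃ (n : ℕ) (b : Basis (Fin n) F V), IsTridiagonalDiagonalBasis b B A)

/-- `A` is multiplicity-free, `θ` is an ordering of its eigenvalues (without repetition), and for
each `i` the map `E i` is the primitive idempotent of `A` for `θ i`: it is the identity on the
eigenspace for `θ i` and vanishes on all the other eigenspaces. -/
structure IsPrimitiveIdempotents {d : ℕ} (A : End F V) (θ : Fin (d + 1) → F)
    (E : Fin (d + 1) → End F V) : Prop where
  injective : Function.Injective θ
  finrank_eigenspace : ∀ i, finrank F (End.eigenspace A (θ i)) = 1
  iSup_eigenspace : ⨆ i, End.eigenspace A (θ i) = ⊤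
  apply_same : ∀ i, ∀ v ∈ End.eigenspace A (θ i), E i v = v
  apply_ne : ∀ i j, j ≠ i → ∀ v ∈ End.eigenspace A (θ j), E i v = 0

/-- For the Leonard pair `A, B`, the sequence `E` is a standard ordering of the primitive
idempotents of `A`: a basis with `i`-th vector in `E i V` makes `B` irreducible tridiagonal and
`A` diagonal. -/
def IsStandardOrdering {d : ℕ} (A B : End F V) (E : Fin (d + 1) → End F V) : Prop :=
  (∃ θ : Fin (d + 1) → F, IsPrimitiveIdempotents A θ E) ∧
  ∃ b : Basis (Fin (d + 1)) F V,
    (∀ i, b i ∈ LinearMap.range (E i)) ∧ IsTridiagonalDiagonalBasis b B A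

end Pairs

/-- A Leonard system `(A; {E_i}; A*; {E*_i})` on `V`, with indices `0, …, d`. -/
structure LeonardSystem (F V : Type*) [Field F] [AddCommGroup V] [Module F V] (d : ℕ) where
  A : End F V
  E : Fin (d + 1) → End F V
  Astar : End F V
  Estar : Fin (d + 1) → End F V
  isLeonardPair : IsLeonardPair A Astar
  isStandard : IsStandardOrdering A Astar E
  isStandard_star : IsStandardOrdering Astar A Estar

section Polynomials

variable {F : Type*} [Field F] {d : ℕ}

/-- `(x - θ_0)(x - θ_1) ⋯ (x - θ_{i-1})`, for `i ≤ d + 1`. -/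
noncomputable def tauPoly (θ : Fin (d + 1) → F) (i : ℕ) : F[X] :=
  ∏ j ∈ Finset.univ.filter (fun j : Fin (d + 1) => (j : ℕ) < i), (X - C (θ j))

/-- `(x - θ_d)(x - θ_{d-1}) ⋯ (x - θ_{d-i+1})`, for `i ≤ d + 1`. -/
noncomputable def etaPoly (θ : Fin (d + 1) → F) (i : ℕ) : F[X] :=
  ∏ j ∈ Finset.univ.filter (fun j : Fin (d + 1) => (j : ℕ) < i), (X - C (θ j.rev))

end Polynomials

namespace LeonardSystem

variable {F V V' : Type*} [Field F] [AddCommGroup V] [Module F V] [AddCommGroup V'] [Module F V']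
  {d : ℕ}

/-- `Φ* = (A*; {E*_i}; A; {E_i})`. For an object `f` attached to `Φ`, the object `f*` is the
corresponding one attached to `Φ.dual`. -/
def dual (Φ : LeonardSystem F V d) : LeonardSystem F V d where
  A := Φ.Astar
  E := Φ.Estar
  Astar := Φ.A
  Estar := Φ.E
  isLeonardPair := ⟨Φ.isLeonardPair.2, Φ.isLeonardPair.1⟩
  isStandard := Φ.isStandard_star
  isStandard_star := Φ.isStandard

/-- The eigenvalue sequence of `Φ`: `Φ.theta i` is the eigenvalue of `A` corresponding to `E i`
(it is uniquely determined). -/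
noncomputable def theta (Φ : LeonardSystem F V d) : Fin (d + 1) → F :=
  Φ.isStandard.1.choose

theorem theta_spec (Φ : LeonardSystem F V d) : IsPrimitiveIdempotents Φ.A Φ.theta Φ.E :=
  Φ.isStandard.1.choose_spec

/-- The dual eigenvalue sequence of `Φ`. -/
noncomputable def thetaStar (Φ : LeonardSystem F V d) : Fin (d + 1) → F :=
  Φ.dual.theta

/-- `T = ∑_{i=0}^d η_{d-i}(A) E*_0 E_d τ*_i(A*)`. -/
noncomputable def T (Φ : LeonardSystem F V d) : End F V :=
  ∑ i ∈ Finset.range (d + 1),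
    aeval Φ.A (etaPoly Φ.theta (d - i)) * Φ.Estar 0 * Φ.E (Fin.last d) *
      aeval Φ.Astar (tauPoly Φ.thetaStar i)

/-- `σ` is an isomorphism of Leonard systems from `Φ` to `Ψ`. -/
structure IsIsomorphism (Φ : LeonardSystem F V d) (Ψ : LeonardSystem F V' d)
    (σ : End F V ≃ₐ[F] End F V') : Prop where
  map_A : σ Φ.A = Ψ.A
  map_E : ∀ i, σ (Φ.E i) = Ψ.E i
  map_Astar : σ Φ.Astar = Ψ.Astar
  map_Estar : ∀ i, σ (Φ.Estar i) = Ψ.Estar i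

/-- `Φ` is isomorphic to `Φ*`. -/
def IsSelfDual (Φ : LeonardSystem F V d) : Prop :=
  ∃ σ : End F V ≃ₐ[F] End F V, IsIsomorphism Φ Φ.dual σ

/-- `σ` is the duality `Φ ↔ Φ*`. -/
def IsDuality (Φ : LeonardSystem F V d) (σ : End F V ≃ₐ[F] End F V) : Prop :=
  IsIsomorphism Φ Φ.dual σ ∧ IsIsomorphism Φ.dual Φ σ

/-- `ξ` is an antiautomorphism of `End(V)` that fixes `A` and `A*`. -/
structure IsDagger (Φ : LeonardSystem F V d) (ξ : End F V ≃ₗ[F] End F V) : Prop where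
  map_mul_rev : ∀ X Y, ξ (X * Y) = ξ Y * ξ X
  map_A : ξ Φ.A = Φ.A
  map_Astar : ξ Φ.Astar = Φ.Astar

end LeonardSystem

/-- `K` is an `F`-linear bijection and `σ X = K X K⁻¹` for all `X`. -/
def Gives {F V V' : Type*} [Field F] [AddCommGroup V] [Module F V] [AddCommGroup V'] [Module F V']
    (K : V →ₗ[F] V') (σ : End F V ≃ₐ[F] End F V') : Prop :=
  ∃ e : V ≃ₗ[F] V', (e : V →ₗ[F] V') = K ∧
    ∀ X : End F V, σ X = (e : V →ₗ[F] V') ∘ₗ X ∘ₗ (e.symm : V' →ₗ[F] V)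

end Leonard

/-! The argument rests on rigidity: `E_0 V` is a cyclic line for `A*`, so a map that commutes with
`A*` and preserves that line is a scalar (`eq_smul_one_of_commute_Astar`). Any automorphism of
`End(V)` is conjugation by some `K`, so one that fixes both `A` and `A*` is the identity. This gives
uniqueness of `σ` and of the dagger. The dagger exists because a diagonal rescaling symmetrizes an
irreducible tridiagonal matrix.

Let `σ` be the given duality, conjugation by `K`. Then `θ* = θ`, and a telescoping sum gives `A T =
T A*` (`A_mul_T`). Also `T E_0` has image in `E*_0 V`. Hence `K⁻¹T` commutes with `A*` and preserves
`E_0 V`, so `T` is a multiple of `K`, nonzero since `T E_0 ≠ 0`. So `T` is invertible and `σ` is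
conjugation by `T`; thus `σ` fixes `T`, while it visibly sends `T` to `T*`. Finally, `T†` has the
same intertwining relations as `T`, so it is a multiple of `T`; the closed forms of `T E_0` and `T*
E*_0` show that the factor is `1`. -/

namespace Leonard

/-! ### Irreducible tridiagonal maps -/

section Tridiagonal

variable {F V : Type*} [Field F] [AddCommGroup V] [Module F V] {d : ℕ}

theorem repr_apply_eq_sum {n : ℕ} (b : Basis (Fin n) F V) (B : End F V) (x : V) (i : Fin n) :
    b.repr (B x) i = ∑ j, LinearMap.toMatrix b b B i j * b.repr x j := by
  rw [← LinearMap.toMatrix_mulVec_repr b b B x]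
  rfl

theorem IsTridiagonal.eq_zero_of_lt {n : ℕ} {M : Matrix (Fin n) (Fin n) F} (hM : IsTridiagonal M)
    {i j : Fin n} (h : (j : ℕ) + 1 < i) : M i j = 0 := by
  by_contra h0
  have := (hM i j h0).1
  omega

theorem IsTridiagonal.eq_zero_of_gt {n : ℕ} {M : Matrix (Fin n) (Fin n) F} (hM : IsTridiagonal M)
    {i j : Fin n} (h : (i : ℕ) + 1 < j) : M i j = 0 := by
  by_contra h0
  have := (hM i j h0).2
  omega

/-- The first basis vector is cyclic for an irreducible tridiagonal map: a map in the commutant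
that scales it is a scalar. -/
theorem eq_smul_one_of_commute {b : Basis (Fin (d + 1)) F V} {B M : End F V}
    (hB : IsIrreducibleTridiagonal (LinearMap.toMatrix b b B)) (hc : M * B = B * M)
    {c : F} (h0 : M (b 0) = c • b 0) : M = c • 1 := by
  have key : ∀ n (hn : n < d + 1), b ⟨n, hn⟩ ∈ End.eigenspace M c := by
    intro n
    induction n using Nat.strong_induction_on with
    | _ n ih =>
      intro hn
      rcases n with _ | m
      · exact End.mem_eigenspace_iff.2 h0
      · have hm := ih m (by omega) (by omega)
        have hBm : B (b ⟨m, by omega⟩) ∈ End.eigenspace M c := by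
          rw [End.mem_eigenspace_iff] at hm ⊢
          have := LinearMap.congr_fun hc (b ⟨m, by omega⟩)
          simp only [Module.End.mul_apply] at this
          rw [this, hm, map_smul]
        have hsum : B (b ⟨m, by omega⟩) =
            ∑ k, LinearMap.toMatrix b b B k ⟨m, by omega⟩ • b k := by
          simp only [LinearMap.toMatrix_apply]
          exact (b.sum_repr _).symm
        -- In `B b_m`, the vector `b_{m+1}` has a nonzero coefficient and all other terms are
        -- already known to lie in the eigenspace.
        rw [hsum, ← Finset.add_sum_erase _ _ (Finset.mem_univ (⟨m + 1, hn⟩ : Fin (d + 1)))] at hBm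
        have hrest : ∑ k ∈ Finset.univ.erase (⟨m + 1, hn⟩ : Fin (d + 1)),
            LinearMap.toMatrix b b B k ⟨m, by omega⟩ • b k ∈ End.eigenspace M c := by
          refine Submodule.sum_mem _ fun k hk => ?_
          have hk' : (k : ℕ) ≠ m + 1 := fun h => (Finset.ne_of_mem_erase hk) (Fin.ext h)
          rcases lt_or_gt_of_ne hk' with h | h
          · exact Submodule.smul_mem _ _ (ih k h k.2)
          · rw [hB.1.eq_zero_of_lt (by simpa using h), zero_smul]
            exact Submodule.zero_mem _
        have := (Submodule.add_mem_iff_left _ hrest).1 hBm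
        exact (Submodule.smul_mem_iff _ (hB.2 ⟨m, by omega⟩ ⟨m + 1, hn⟩ rfl).2).1 this
  refine b.ext fun i => ?_
  simpa using End.mem_eigenspace_iff.1 (key i i.2)

/-- An eigenvector of an irreducible tridiagonal map has nonzero first coordinate. -/
theorem eq_zero_of_repr_zero_eq_zero {b : Basis (Fin (d + 1)) F V} {B : End F V}
    (hB : IsIrreducibleTridiagonal (LinearMap.toMatrix b b B)) {c : F} {w : V}
    (hw : B w = c • w) (h0 : b.repr w 0 = 0) : w = 0 := by
  have key : ∀ n (hn : n < d + 1), b.repr w ⟨n, hn⟩ = 0 := by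
    intro n
    induction n using Nat.strong_induction_on with
    | _ n ih =>
      intro hn
      rcases n with _ | m
      · exact h0
      -- Row `m` of `B w = c w` is a three-term recurrence, solvable for coordinate `m + 1`.
      · have h1 := repr_apply_eq_sum b B w ⟨m, by omega⟩
        rw [hw, map_smul, Finsupp.smul_apply, ih m (by omega), smul_zero,
          Finset.sum_eq_single (⟨m + 1, hn⟩ : Fin (d + 1))] at h1
        · exact (mul_eq_zero.1 h1.symm).resolve_left (hB.2 ⟨m, by omega⟩ ⟨m + 1, hn⟩ rfl).1
        · intro k _ hk
          have hk' : (k : ℕ) ≠ m + 1 := fun h => hk (Fin.ext h)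
          rcases lt_or_gt_of_ne hk' with h | h
          · rw [ih k h k.2, mul_zero]
          · rw [hB.1.eq_zero_of_gt (by simpa using h), zero_mul]
        · simp
  refine b.repr.map_eq_zero_iff.1 (Finsupp.ext fun i => key i i.2)

theorem tauPoly_zero (θ : Fin (d + 1) → F) : tauPoly θ 0 = 1 := by
  simp [tauPoly]

theorem etaPoly_zero (θ : Fin (d + 1) → F) : etaPoly θ 0 = 1 := by
  simp [etaPoly]

theorem tauPoly_succ (θ : Fin (d + 1) → F) {i : ℕ} (hi : i < d + 1) :
    tauPoly θ (i + 1) = (X - C (θ ⟨i, hi⟩)) * tauPoly θ i := by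
  have : Finset.univ.filter (fun j : Fin (d + 1) => (j : ℕ) < i + 1) =
      insert ⟨i, hi⟩ (Finset.univ.filter (fun j : Fin (d + 1) => (j : ℕ) < i)) := by
    ext j
    simp [Fin.ext_iff]
    omega
  rw [tauPoly, this, Finset.prod_insert (by simp), tauPoly]

theorem etaPoly_eq_tauPoly (θ : Fin (d + 1) → F) (i : ℕ) :
    etaPoly θ i = tauPoly (fun j => θ j.rev) i := rfl

/-- The new factor is `x - θ_i` because the index `d - i` reverses to `i`. It therefore matches the
factor gained by `τ_{i+1}`, which drives the telescoping in `A_mul_T`. -/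
theorem etaPoly_succ (θ : Fin (d + 1) → F) {i : ℕ} (hi : i < d + 1) :
    etaPoly θ (d - i + 1) = (X - C (θ ⟨i, hi⟩)) * etaPoly θ (d - i) := by
  rw [etaPoly_eq_tauPoly, tauPoly_succ _ (by omega : d - i < d + 1), ← etaPoly_eq_tauPoly]
  congr 4
  ext
  simp [Fin.val_rev]
  omega

/-- Each factor `B - θ_j` pushes the support up by at most one index, and the new top coordinate is
multiplied by a nonzero subdiagonal entry. The scalars `θ_j` play no role. -/
theorem repr_aeval_tauPoly {b : Basis (Fin (d + 1)) F V} {B : End F V}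
    (hB : IsIrreducibleTridiagonal (LinearMap.toMatrix b b B)) (θ : Fin (d + 1) → F) :
    ∀ i (hi : i < d + 1),
      (∀ j : Fin (d + 1), i < j → b.repr (aeval B (tauPoly θ i) (b 0)) j = 0) ∧
      b.repr (aeval B (tauPoly θ i) (b 0)) ⟨i, hi⟩ ≠ 0 := by
  intro i
  induction i with
  | zero =>
    intro hi
    rw [tauPoly_zero]
    refine ⟨fun j hj => ?_, ?_⟩
    · have : (0 : Fin (d + 1)) ≠ j := by rintro rfl; simp at hj
      simp [this]
    · simp
  | succ i ih =>
    intro hi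
    obtain ⟨h1, h2⟩ := ih (by omega)
    rw [tauPoly_succ θ (by omega : i < d + 1)]
    simp only [map_mul, map_sub, aeval_X, aeval_C, Module.End.mul_apply, LinearMap.sub_apply,
      Module.algebraMap_end_apply, map_smul, Finsupp.sub_apply, Finsupp.smul_apply]
    refine ⟨fun j hj => ?_, ?_⟩
    · rw [h1 j (by omega), smul_zero, sub_zero, repr_apply_eq_sum]
      refine Finset.sum_eq_zero fun k _ => ?_
      rcases Nat.lt_or_ge i k with h | h
      · rw [h1 k h, mul_zero]
      · rw [hB.1.eq_zero_of_lt (by omega), zero_mul]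
    · rw [h1 ⟨i + 1, hi⟩ (by simp), smul_zero, sub_zero, repr_apply_eq_sum,
        Finset.sum_eq_single (⟨i, by omega⟩ : Fin (d + 1))]
      · exact mul_ne_zero (hB.2 ⟨i, by omega⟩ ⟨i + 1, hi⟩ rfl).2 h2
      · intro k _ hk
        have hk' : (k : ℕ) ≠ i := fun h => hk (Fin.ext h)
        rcases lt_or_gt_of_ne hk' with h | h
        · rw [hB.1.eq_zero_of_lt (by simpa using h), zero_mul]
        · rw [h1 k h, mul_zero]
      · simp

/-- The transpose map, corrected by a diagonal matrix, is an antiautomorphism fixing an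
irreducible tridiagonal map and a diagonal map. -/
theorem exists_antiautomorphism {b : Basis (Fin (d + 1)) F V} {A B : End F V}
    (h : IsTridiagonalDiagonalBasis b A B) :
    ∃ dag : End F V ≃ₗ[F] End F V,
      (∀ X Y, dag (X * Y) = dag Y * dag X) ∧ dag A = A ∧ dag B = B := by
  classical
  let M := LinearMap.toMatrix b b A
  let N := LinearMap.toMatrix b b B
  -- The ratio `k_{j+1} / k_j` forced by `K Mᵗ = M K`; the value `1` out of range is only a nonzero
  -- filler.
  let a : ℕ → F := fun j => if hj : j + 1 < d + 1 then
    M ⟨j + 1, hj⟩ ⟨j, by omega⟩ / M ⟨j, by omega⟩ ⟨j + 1, hj⟩ else 1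
  have hMt : IsIrreducibleTridiagonal M := h.1
  have hNd : N.IsDiag := h.2
  have ha : ∀ j, a j ≠ 0 := by
    intro j
    simp only [a]
    split_ifs with hj
    · have := hMt.2 ⟨j, by omega⟩ ⟨j + 1, hj⟩ rfl
      exact div_ne_zero this.2 this.1
    · exact one_ne_zero
  let k : Fin (d + 1) → F := fun i => ∏ j ∈ Finset.range i, a j
  have hk : ∀ i, k i ≠ 0 := fun i => Finset.prod_ne_zero_iff.2 fun j _ => ha j
  let K : Matrix (Fin (d + 1)) (Fin (d + 1)) F := Matrix.diagonal k
  let K' : Matrix (Fin (d + 1)) (Fin (d + 1)) F := Matrix.diagonal fun i => (k i)⁻¹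
  have hKK' : K * K' = 1 := by simp [K, K', hk]
  have hK'K : K' * K = 1 := by simp [K, K', hk]
  have hstep : ∀ i j : Fin (d + 1), (i : ℕ) + 1 = j → k i * M j i = M i j * k j := by
    intro i j hij
    have hj : (i : ℕ) + 1 < d + 1 := hij ▸ j.2
    obtain rfl : j = ⟨i + 1, hj⟩ := Fin.ext hij.symm
    have h1 := (hMt.2 i ⟨i + 1, hj⟩ rfl).1
    have h2 : k ⟨i + 1, hj⟩ = k i * a i := Finset.prod_range_succ _ _
    rw [h2]
    simp only [a, dif_pos hj]
    field_simp
  have hMK : K * M.transpose = M * K := by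
    ext i j
    simp only [K, Matrix.diagonal_mul, Matrix.mul_diagonal, Matrix.transpose_apply]
    rcases lt_trichotomy ((i : ℕ) + 1) j with hij | hij | hij
    · rw [hMt.1.eq_zero_of_lt hij, hMt.1.eq_zero_of_gt hij, mul_zero, zero_mul]
    · exact hstep i j hij
    · rcases lt_trichotomy ((j : ℕ) + 1) i with hji | hji | hji
      · rw [hMt.1.eq_zero_of_lt hji, hMt.1.eq_zero_of_gt hji, mul_zero, zero_mul]
      · linear_combination -hstep j i hji
      · obtain rfl : i = j := Fin.ext (by omega)
        exact mul_comm _ _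
  have hNK : K * N.transpose = N * K := by
    ext i j
    simp only [K, Matrix.diagonal_mul, Matrix.mul_diagonal, Matrix.transpose_apply]
    rcases eq_or_ne i j with rfl | hij
    · exact mul_comm _ _
    · rw [hNd hij, hNd hij.symm, mul_zero, zero_mul]
  let f : Matrix (Fin (d + 1)) (Fin (d + 1)) F ≃ₗ[F] Matrix (Fin (d + 1)) (Fin (d + 1)) F :=
    LinearEquiv.ofLinearMap
      { toFun := fun X => K * X.transpose * K'
        map_add' := fun X Y => by simp [mul_add, add_mul]
        map_smul' := fun c X => by simp }
      { toFun := fun X => (K' * X * K).transpose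
        map_add' := fun X Y => by simp [mul_add, add_mul]
        map_smul' := fun c X => by simp }
      (by
        ext1 X
        simp only [LinearMap.comp_apply, LinearMap.coe_mk, AddHom.coe_mk,
          Matrix.transpose_transpose, LinearMap.id_apply]
        rw [← mul_assoc, ← mul_assoc, hKK', one_mul, mul_assoc, hKK', mul_one])
      (by
        ext1 X
        simp only [LinearMap.comp_apply, LinearMap.coe_mk, AddHom.coe_mk, LinearMap.id_apply]
        rw [← mul_assoc, ← mul_assoc, hK'K, one_mul, mul_assoc, hK'K, mul_one,
          Matrix.transpose_transpose])
  have hf : ∀ X, f X = K * X.transpose * K' := fun X => rfl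
  have hfmul : ∀ X Y, f (X * Y) = f Y * f X := by
    intro X Y
    rw [hf, hf, hf, Matrix.transpose_mul]
    calc K * (Y.transpose * X.transpose) * K'
        = K * Y.transpose * (1 * (X.transpose * K')) := by simp only [mul_assoc, one_mul]
      _ = K * Y.transpose * (K' * K * (X.transpose * K')) := by rw [hK'K]
      _ = _ := by simp only [mul_assoc]
  have hfix : ∀ X, K * X.transpose = X * K → f X = X := by
    intro X hX
    rw [hf, hX, mul_assoc, hKK', mul_one]
  let e := LinearMap.toMatrix b b
  have he : ∀ X Y, e (X * Y) = e X * e Y := fun X Y => LinearMap.toMatrix_mul b X Y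
  refine ⟨(e.trans f).trans e.symm, fun X Y => e.injective ?_, e.injective ?_, e.injective ?_⟩
  · simp [he, hfmul]
  · simpa using hfix _ hMK
  · simpa using hfix _ hNK

end Tridiagonal

end Leonard

namespace Leonard

/-! ### Calculus of primitive idempotents -/

namespace IsPrimitiveIdempotents

variable {F V : Type*} [Field F] [AddCommGroup V] [Module F V] {d : ℕ}
  {A : End F V} {θ : Fin (d + 1) → F} {E : Fin (d + 1) → End F V}

theorem end_ext (h : IsPrimitiveIdempotents A θ E) {X Y : End F V}
    (hXY : ∀ i, ∀ v ∈ End.eigenspace A (θ i), X v = Y v) : X = Y := by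
  have : ⨆ i, End.eigenspace A (θ i) ≤ LinearMap.eqLocus X Y :=
    iSup_le fun i v hv => hXY i v hv
  rw [h.iSup_eigenspace] at this
  exact LinearMap.ext fun v => this (Submodule.mem_top (x := v))

theorem apply_eigenvector (h : IsPrimitiveIdempotents A θ E) (i j : Fin (d + 1)) {v : V}
    (hv : v ∈ End.eigenspace A (θ j)) : E i v = if i = j then v else 0 := by
  split_ifs with hij
  · subst hij
    exact h.apply_same i v hv
  · exact h.apply_ne i j (Ne.symm hij) v hv

theorem mul_idempotent (h : IsPrimitiveIdempotents A θ E) (i : Fin (d + 1)) :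
    A * E i = θ i • E i := by
  refine h.end_ext fun j v hv => ?_
  simp only [Module.End.mul_apply, LinearMap.smul_apply, h.apply_eigenvector i j hv]
  split_ifs with hij
  · subst hij
    exact End.mem_eigenspace_iff.1 hv
  · simp

theorem idempotent_mul_idempotent (h : IsPrimitiveIdempotents A θ E) (i j : Fin (d + 1)) :
    E i * E j = if i = j then E j else 0 := by
  refine LinearMap.ext fun v => ?_
  have hv : E j v ∈ End.eigenspace A (θ j) :=
    End.mem_eigenspace_iff.2 (LinearMap.congr_fun (h.mul_idempotent j) v)
  rw [Module.End.mul_apply, h.apply_eigenvector i j hv]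
  split_ifs <;> rfl

theorem sum_idempotent (h : IsPrimitiveIdempotents A θ E) : ∑ i, E i = 1 := by
  refine h.end_ext fun j v hv => ?_
  simp [LinearMap.sum_apply, h.apply_eigenvector _ j hv]

theorem aeval_mul_idempotent (h : IsPrimitiveIdempotents A θ E) (p : F[X]) (i : Fin (d + 1)) :
    aeval A p * E i = p.eval (θ i) • E i :=
  LinearMap.ext fun v =>
    End.aeval_apply_of_mem_apply_eq_smul (LinearMap.congr_fun (h.mul_idempotent i) v)

theorem aeval_eq_sum (h : IsPrimitiveIdempotents A θ E) (p : F[X]) :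
    aeval A p = ∑ i, p.eval (θ i) • E i := by
  rw [← mul_one (aeval A p), ← h.sum_idempotent, Finset.mul_sum]
  exact Finset.sum_congr rfl fun i _ => h.aeval_mul_idempotent p i

theorem aeval_tauPoly_eq_zero (h : IsPrimitiveIdempotents A θ E) :
    aeval A (tauPoly θ (d + 1)) = 0 := by
  rw [h.aeval_eq_sum]
  refine Finset.sum_eq_zero fun i _ => ?_
  rw [tauPoly, eval_prod, Finset.prod_eq_zero (i := i) (by simp [Fin.is_le]), zero_smul]
  simp

theorem aeval_etaPoly_eq_zero (h : IsPrimitiveIdempotents A θ E) :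
    aeval A (etaPoly θ (d + 1)) = 0 := by
  rw [h.aeval_eq_sum]
  refine Finset.sum_eq_zero fun i _ => ?_
  rw [etaPoly, eval_prod, Finset.prod_eq_zero (i := i.rev) (by simp [Fin.is_le]), zero_smul]
  simp

theorem aeval_tauPoly_eq_smul (h : IsPrimitiveIdempotents A θ E) :
    aeval A (tauPoly θ d) = (tauPoly θ d).eval (θ (Fin.last d)) • E (Fin.last d) := by
  rw [h.aeval_eq_sum]
  refine Finset.sum_eq_single _ (fun i _ hi => ?_) (by simp)
  rw [tauPoly, eval_prod, Finset.prod_eq_zero (i := i), zero_smul]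
  · simpa using Fin.val_lt_last hi
  · simp

theorem idempotent_mul_eq_self (h : IsPrimitiveIdempotents A θ E) {i : Fin (d + 1)}
    {X : End F V} (hX : A * X = θ i • X) : E i * X = X :=
  LinearMap.ext fun v => h.apply_same i _ (End.mem_eigenspace_iff.2 (LinearMap.congr_fun hX v))

/-- Since `A ξ(E_j) = ξ(E_j A) = θ_j ξ(E_j)`, the image of `ξ(E_j)` lies in the `θ_j`-eigenspace.
Multiplying `∑ ξ(E_j) = 1` on the left by `E_i` leaves only `ξ(E_i)`. -/
theorem antiautomorphism_apply (h : IsPrimitiveIdempotents A θ E) {ξ : End F V ≃ₗ[F] End F V}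
    (hmul : ∀ X Y, ξ (X * Y) = ξ Y * ξ X) (hA : ξ A = A) (i : Fin (d + 1)) : ξ (E i) = E i := by
  have hone : ξ 1 = 1 := by
    obtain ⟨X, hX⟩ := ξ.surjective 1
    have := hmul X 1
    rw [mul_one, hX, mul_one] at this
    exact this.symm
  have hAE : ∀ j, E j * A = θ j • E j := fun j => by
    refine h.end_ext fun k v hv => ?_
    have hv' := End.mem_eigenspace_iff.1 hv
    rw [Module.End.mul_apply, hv', map_smul, LinearMap.smul_apply, h.apply_eigenvector j k hv]
    split_ifs with hjk
    · rw [hjk]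
    · simp
  have hself : ∀ j, E j * ξ (E j) = ξ (E j) := fun j => by
    refine h.idempotent_mul_eq_self ?_
    rw [← map_smul, ← hAE, hmul, hA]
  have hsum : ∑ j, ξ (E j) = 1 := by rw [← map_sum, h.sum_idempotent, hone]
  calc ξ (E i) = E i * ∑ j, ξ (E j) := by
        rw [Finset.mul_sum, Finset.sum_eq_single i, hself]
        · intro j _ hj
          rw [← hself j, ← mul_assoc, h.idempotent_mul_idempotent, if_neg hj.symm, zero_mul]
        · simp
    _ = E i := by rw [hsum, mul_one]

theorem mem_eigenspace_of_mem_range (h : IsPrimitiveIdempotents A θ E) {i : Fin (d + 1)} {v : V}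
    (hv : v ∈ LinearMap.range (E i)) : v ∈ End.eigenspace A (θ i) := by
  obtain ⟨w, rfl⟩ := hv
  exact End.mem_eigenspace_iff.2 (LinearMap.congr_fun (h.mul_idempotent i) w)

theorem apply_eq_repr_smul (h : IsPrimitiveIdempotents A θ E) {b : Basis (Fin (d + 1)) F V}
    (hb : ∀ i, b i ∈ LinearMap.range (E i)) (i : Fin (d + 1)) (v : V) :
    E i v = b.repr v i • b i := by
  have hEb : ∀ j, E i (b j) = if i = j then b j else 0 := fun j =>
    h.apply_eigenvector i j (h.mem_eigenspace_of_mem_range (hb j))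
  conv_lhs => rw [← b.sum_repr v, map_sum]
  simp [hEb]

end IsPrimitiveIdempotents

/-! ### Rigidity of the pair, and the dagger -/

namespace LeonardSystem

variable {F V : Type*} [Field F] [AddCommGroup V] [Module F V] {d : ℕ} (Φ : LeonardSystem F V d)

theorem thetaStar_spec : IsPrimitiveIdempotents Φ.Astar Φ.thetaStar Φ.Estar :=
  Φ.dual.theta_spec

theorem E_ne_zero (i : Fin (d + 1)) : Φ.E i ≠ 0 := by
  obtain ⟨b, hb, -⟩ := Φ.isStandard.2
  intro h
  have := hb i
  rw [h, LinearMap.range_zero, Submodule.mem_bot] at this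
  exact b.ne_zero i this

/-- A map commuting with `A*` and stabilizing `E_0 V` is a scalar. -/
theorem eq_smul_one_of_commute_Astar {M : End F V} (hM : M * Φ.Astar = Φ.Astar * M)
    (h0 : Φ.E 0 * M * Φ.E 0 = M * Φ.E 0) : ∃ c : F, M = c • 1 := by
  obtain ⟨b, hb, htri, -⟩ := Φ.isStandard.2
  refine ⟨b.repr (M (b 0)) 0, eq_smul_one_of_commute htri hM ?_⟩
  have hb0 : Φ.E 0 (b 0) = b 0 :=
    Φ.theta_spec.apply_same 0 _ (Φ.theta_spec.mem_eigenspace_of_mem_range (hb 0))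
  have := LinearMap.congr_fun h0 (b 0)
  simp only [Module.End.mul_apply, hb0] at this
  rw [← Φ.theta_spec.apply_eq_repr_smul hb, this]

theorem eq_smul_one_of_commute_both {M : End F V} (hA : M * Φ.A = Φ.A * M)
    (hM : M * Φ.Astar = Φ.Astar * M) : ∃ c : F, M = c • 1 := by
  refine Φ.eq_smul_one_of_commute_Astar hM ?_
  rw [mul_assoc]
  refine Φ.theta_spec.idempotent_mul_eq_self ?_
  rw [← mul_assoc, ← hA, mul_assoc, Φ.theta_spec.mul_idempotent, mul_smul_comm]

/-- The automorphism is conjugation by a linear bijection, which here commutes with `A` and `A*` and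
so is a scalar. -/
theorem algEquiv_eq_refl {f : End F V ≃ₐ[F] End F V} (hA : f Φ.A = Φ.A)
    (hAs : f Φ.Astar = Φ.Astar) : f = AlgEquiv.refl := by
  obtain ⟨K, rfl⟩ := f.eq_linearEquivConjAlgEquiv
  have hcomm : ∀ {X : End F V}, K.conjAlgEquiv F X = X → (K : End F V) * X = X * K := by
    intro X hX
    conv_rhs => rw [← hX]
    ext v
    simp [LinearEquiv.conjAlgEquiv_apply]
  obtain ⟨c, hc⟩ := Φ.eq_smul_one_of_commute_both (hcomm hA) (hcomm hAs)
  ext X v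
  have h1 : ∀ w, K w = c • w := fun w => LinearMap.congr_fun hc w
  simp only [LinearEquiv.conjAlgEquiv_apply, LinearMap.comp_apply, LinearEquiv.coe_coe,
    AlgEquiv.coe_refl, id_eq]
  rw [h1, ← map_smul, ← h1, LinearEquiv.apply_symm_apply]

theorem isDagger_unique {ξ ξ' : End F V ≃ₗ[F] End F V} (h : Φ.IsDagger ξ)
    (h' : Φ.IsDagger ξ') : ξ' = ξ := by
  -- The two reversals of products cancel, so `e` is an algebra automorphism.
  let e := ξ'.trans ξ.symm
  have he : ∀ X Y, e (X * Y) = e X * e Y := by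
    intro X Y
    refine ξ.injective ?_
    rw [h.map_mul_rev]
    simp [e, h'.map_mul_rev]
  have hone : e 1 = 1 := by
    obtain ⟨X, hX⟩ := e.surjective 1
    have := he X 1
    rw [mul_one, hX, one_mul] at this
    exact this.symm
  have hf := Φ.algEquiv_eq_refl (f := AlgEquiv.ofLinearEquiv e hone he)
    (by simpa [e, h'.map_A] using (ξ.symm_apply_eq.2 h.map_A.symm))
    (by simpa [e, h'.map_Astar] using (ξ.symm_apply_eq.2 h.map_Astar.symm))
  refine LinearEquiv.ext fun X => ?_
  have : e X = X := congrArg (fun g : End F V ≃ₐ[F] End F V => g X) hf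
  exact (ξ.symm_apply_eq).1 this

theorem exists_isDagger : ∃ ξ : End F V ≃ₗ[F] End F V, Φ.IsDagger ξ := by
  obtain ⟨b, -, hb⟩ := Φ.isStandard_star.2
  obtain ⟨ξ, h1, h2, h3⟩ := exists_antiautomorphism hb
  exact ⟨ξ, h1, h2, h3⟩

/-! ### The element `T` -/

theorem idempotent_tauPoly_idempotent_eq_zero {i : ℕ} (hi : i < d) (θ : Fin (d + 1) → F) :
    Φ.E (Fin.last d) * aeval Φ.Astar (tauPoly θ i) * Φ.E 0 = 0 := by
  obtain ⟨b, hb, htri, -⟩ := Φ.isStandard.2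
  ext v
  simp only [Module.End.mul_apply, Φ.theta_spec.apply_eq_repr_smul hb, map_smul]
  rw [(repr_aeval_tauPoly htri θ i (by omega)).1 _ (by simpa using hi)]
  simp

/-- For `i < d` the factor `E_d τ*_i(A*) E_0` vanishes, as `i` steps cannot reach index `d` from
`0`. -/
theorem T_mul_E_zero : Φ.T * Φ.E 0 =
    Φ.Estar 0 * Φ.E (Fin.last d) * aeval Φ.Astar (tauPoly Φ.thetaStar d) * Φ.E 0 := by
  rw [T, Finset.sum_mul, Finset.sum_range_succ, Finset.sum_eq_zero, zero_add, Nat.sub_self,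
    etaPoly_zero, map_one, one_mul]
  intro i hi
  simp only [mul_assoc]
  rw [← mul_assoc (Φ.E (Fin.last d)),
    Φ.idempotent_tauPoly_idempotent_eq_zero (Finset.mem_range.1 hi), mul_zero, mul_zero]

theorem T_mul_E_zero_eq_smul : Φ.T * Φ.E 0 =
    (tauPoly Φ.thetaStar d).eval (Φ.thetaStar (Fin.last d)) •
      (Φ.Estar 0 * Φ.E (Fin.last d) * Φ.Estar (Fin.last d) * Φ.E 0) := by
  rw [T_mul_E_zero, Φ.thetaStar_spec.aeval_tauPoly_eq_smul, mul_smul_comm, smul_mul_assoc]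

theorem T_mul_E_zero_ne_zero : Φ.T * Φ.E 0 ≠ 0 := by
  obtain ⟨b, hb, htri, -⟩ := Φ.isStandard.2
  obtain ⟨b', hb', htri', -⟩ := Φ.isStandard_star.2
  rw [T_mul_E_zero]
  intro h
  have h1 := LinearMap.congr_fun h (b 0)
  simp only [Module.End.mul_apply, Φ.theta_spec.apply_eq_repr_smul hb, map_smul,
    LinearMap.zero_apply, Basis.repr_self, Finsupp.single_eq_same, one_smul] at h1
  have h2 := (smul_eq_zero.1 h1).resolve_left
    (repr_aeval_tauPoly htri Φ.thetaStar d (by omega)).2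
  rw [Φ.thetaStar_spec.apply_eq_repr_smul hb'] at h2
  -- What remains would force an eigenvector of `A` to have zero first coordinate in the eigenbasis
  -- of `A*`, where `A` is irreducible tridiagonal.
  refine b.ne_zero (Fin.last d) (eq_zero_of_repr_zero_eq_zero htri' (c := Φ.theta (Fin.last d))
    ?_ ((smul_eq_zero.1 h2).resolve_right (b'.ne_zero 0)))
  exact End.mem_eigenspace_iff.1 (Φ.theta_spec.mem_eigenspace_of_mem_range (hb _))

theorem A_mul_T (hθ : Φ.thetaStar = Φ.theta) : Φ.A * Φ.T = Φ.T * Φ.Astar := by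
  -- Telescoping potential: the terms with `θ_i` and `θ*_i` cancel because the two sequences agree,
  -- and both ends vanish by the degree `d + 1` annihilating polynomials.
  let f : ℕ → End F V := fun i => aeval Φ.A (etaPoly Φ.theta (d + 1 - i)) * Φ.Estar 0 *
    Φ.E (Fin.last d) * aeval Φ.Astar (tauPoly Φ.thetaStar i)
  rw [← sub_eq_zero, T, Finset.mul_sum, Finset.sum_mul, ← Finset.sum_sub_distrib]
  have key : ∀ i ∈ Finset.range (d + 1),
      Φ.A * (aeval Φ.A (etaPoly Φ.theta (d - i)) * Φ.Estar 0 * Φ.E (Fin.last d) *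
        aeval Φ.Astar (tauPoly Φ.thetaStar i)) -
      aeval Φ.A (etaPoly Φ.theta (d - i)) * Φ.Estar 0 * Φ.E (Fin.last d) *
        aeval Φ.Astar (tauPoly Φ.thetaStar i) * Φ.Astar = f i - f (i + 1) := by
    intro i hi
    have hi' := Finset.mem_range.1 hi
    have h1 : d + 1 - i = d - i + 1 := by omega
    have h2 : d + 1 - (i + 1) = d - i := by omega
    simp only [f]
    rw [h1, h2, etaPoly_succ _ hi', tauPoly_succ _ hi', mul_comm _ (tauPoly Φ.thetaStar i), hθ]
    simp only [map_mul, map_sub, aeval_X, aeval_C, Algebra.algebraMap_eq_smul_one, sub_mul,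
      mul_sub, smul_mul_assoc, mul_smul_comm, one_mul, mul_one, mul_assoc]
    abel
  rw [Finset.sum_congr rfl key, Finset.sum_range_sub']
  simp only [f]
  rw [Nat.sub_zero, Φ.theta_spec.aeval_etaPoly_eq_zero, Φ.thetaStar_spec.aeval_tauPoly_eq_zero]
  simp

/-! ### Consequences of self-duality -/

variable {Φ}

/-- Apply `σ` to `A E_i = θ_i E_i`, compare with `A* E*_i = θ*_i E*_i`, and cancel `E*_i ≠ 0`. -/
theorem IsIsomorphism.thetaStar_eq {σ : End F V ≃ₐ[F] End F V}
    (hσ : IsIsomorphism Φ Φ.dual σ) : Φ.thetaStar = Φ.theta := by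
  funext i
  have h1 := congrArg σ (Φ.theta_spec.mul_idempotent i)
  rw [map_mul, map_smul, hσ.map_A, hσ.map_E, Φ.dual.theta_spec.mul_idempotent] at h1
  exact smul_left_injective F (Φ.dual.E_ne_zero i) h1

theorem IsIsomorphism.exists_eq_T_mul_mul {σ : End F V ≃ₐ[F] End F V}
    (hσ : IsIsomorphism Φ Φ.dual σ) :
    ∃ S : End F V, Φ.T * S = 1 ∧ S * Φ.T = 1 ∧ ∀ X, σ X = Φ.T * X * S := by
  obtain ⟨K, hK⟩ := σ.eq_linearEquivConjAlgEquiv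
  let k : End F V := K.toLinearMap
  let k' : End F V := K.symm.toLinearMap
  have hkk' : k * k' = 1 := by ext v; simp [k, k']
  have hk'k : k' * k = 1 := by ext v; simp [k, k']
  have hσk : ∀ X, σ X = k * X * k' := fun X => by rw [hK]; rfl
  have hk'σ : ∀ X, k' * σ X = X * k' := fun X => by
    rw [hσk, ← mul_assoc, ← mul_assoc, hk'k, one_mul]
  obtain ⟨c, hc⟩ := Φ.eq_smul_one_of_commute_Astar (M := k' * Φ.T)
    (by
      have h := hk'σ Φ.Astar
      rw [hσ.map_Astar] at h
      rw [mul_assoc, ← Φ.A_mul_T hσ.thetaStar_eq, ← mul_assoc, ← mul_assoc, ← h]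
      rfl)
    (by
      have h := hk'σ (Φ.E 0)
      rw [hσ.map_E] at h
      have h' : k' * Φ.Estar 0 = Φ.E 0 * k' := h
      have hidem := Φ.thetaStar_spec.idempotent_mul_idempotent 0 0
      rw [if_pos rfl] at hidem
      rw [mul_assoc, mul_assoc, T_mul_E_zero]
      simp only [← mul_assoc]
      rw [← h', mul_assoc k', hidem])
  have hT : Φ.T = c • k := by
    rw [← one_mul Φ.T, ← hkk', mul_assoc, hc, mul_smul_comm, mul_one]
  have hc0 : c ≠ 0 := by
    rintro rfl
    refine Φ.T_mul_E_zero_ne_zero ?_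
    rw [hT, zero_smul, zero_mul]
  refine ⟨c⁻¹ • k', ?_, ?_, fun X => ?_⟩
  · rw [hT, smul_mul_smul_comm, mul_inv_cancel₀ hc0, hkk', one_smul]
  · rw [hT, smul_mul_smul_comm, inv_mul_cancel₀ hc0, hk'k, one_smul]
  · rw [hT, smul_mul_assoc, smul_mul_smul_comm, mul_inv_cancel₀ hc0, one_smul, hσk]

theorem IsIsomorphism.map_T {σ : End F V ≃ₐ[F] End F V}
    (hσ : IsIsomorphism Φ Φ.dual σ) : σ Φ.T = Φ.dual.T := by
  have hθ : Φ.dual.theta = Φ.theta := hσ.thetaStar_eq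
  have hθ' : Φ.dual.thetaStar = Φ.thetaStar := hσ.thetaStar_eq.symm
  have haeval : ∀ (X : End F V) (p : F[X]), σ (aeval X p) = aeval (σ X) p :=
    fun X p => (aeval_algHom_apply σ.toAlgHom X p).symm
  rw [T, T, map_sum]
  simp only [map_mul, haeval, hσ.map_A, hσ.map_Astar, hσ.map_E, hσ.map_Estar, hθ, hθ']

theorem IsIsomorphism.T_eq_dual_T {σ : End F V ≃ₐ[F] End F V}
    (hσ : IsIsomorphism Φ Φ.dual σ) : Φ.T = Φ.dual.T := by
  obtain ⟨S, hTS, -, hS⟩ := hσ.exists_eq_T_mul_mul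
  rw [← hσ.map_T, hS, mul_assoc, hTS, mul_one]

theorem IsIsomorphism.T_eq_dagger_T {σ : End F V ≃ₐ[F] End F V}
    (hσ : IsIsomorphism Φ Φ.dual σ) {ξ : End F V ≃ₗ[F] End F V} (hξ : Φ.IsDagger ξ) :
    Φ.T = ξ Φ.T := by
  obtain ⟨S, hTS, hST, hS⟩ := hσ.exists_eq_T_mul_mul
  have hT : ∀ X, σ X * Φ.T = Φ.T * X := fun X => by rw [hS, mul_assoc, hST, mul_one]
  have hSσ : ∀ X, S * σ X = X * S := fun X => by
    rw [hS, ← mul_assoc, ← mul_assoc, hST, one_mul]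
  have hA := hσ.map_A
  have hAs := hσ.map_Astar
  change σ Φ.A = Φ.Astar at hA
  change σ Φ.Astar = Φ.A at hAs
  have h1 := congrArg ξ (hT Φ.A)
  have h2 := congrArg ξ (hT Φ.Astar)
  rw [hA, hξ.map_mul_rev, hξ.map_mul_rev, hξ.map_A, hξ.map_Astar] at h1
  rw [hAs, hξ.map_mul_rev, hξ.map_mul_rev, hξ.map_A, hξ.map_Astar] at h2
  -- The dagger exchanges the relations `A* T = T A` and `A T = T A*`, so `T†` satisfies both as
  -- well.
  obtain ⟨c, hc⟩ := Φ.eq_smul_one_of_commute_both (M := S * ξ Φ.T)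
    (by rw [mul_assoc, h2, ← mul_assoc, ← hA, hSσ, mul_assoc])
    (by rw [mul_assoc, h1, ← mul_assoc, ← hAs, hSσ, mul_assoc])
  have hξT : ξ Φ.T = c • Φ.T := by
    rw [← one_mul (ξ Φ.T), ← hTS, mul_assoc, hc, mul_smul_comm, mul_one]
  have hE : ∀ i, ξ (Φ.E i) = Φ.E i :=
    Φ.theta_spec.antiautomorphism_apply hξ.map_mul_rev hξ.map_A
  have hEs : ∀ i, ξ (Φ.Estar i) = Φ.Estar i :=
    Φ.thetaStar_spec.antiautomorphism_apply hξ.map_mul_rev hξ.map_Astar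
  have hTE : Φ.T * Φ.Estar 0 = (tauPoly Φ.theta d).eval (Φ.theta (Fin.last d)) •
      (Φ.E 0 * Φ.Estar (Fin.last d) * Φ.E (Fin.last d) * Φ.Estar 0) := by
    rw [hσ.T_eq_dual_T]
    exact Φ.dual.T_mul_E_zero_eq_smul
  have h3 := congrArg ξ hTE
  simp only [map_smul, hξ.map_mul_rev, hE, hEs] at h3
  have h4 : Φ.Estar 0 * Φ.T = Φ.T * Φ.E 0 := by
    rw [← hT, hσ.map_E]
    rfl
  -- The dagger reverses the product formula for `T* E*_0` into the one for `T E_0`; this pins `c`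
  -- to `1`.
  have h5 : Φ.Estar 0 * ξ Φ.T = Φ.T * Φ.E 0 := by
    rw [h3, T_mul_E_zero_eq_smul, hσ.thetaStar_eq]
    simp only [mul_assoc]
  rw [hξT, mul_smul_comm, h4] at h5
  have hc1 : c = 1 :=
    smul_left_injective F Φ.T_mul_E_zero_ne_zero (h5.trans (one_smul F _).symm)
  rw [hξT, hc1, one_smul]

end LeonardSystem

end Leonard

/-- The first two conjuncts say that the antiautomorphism `dag` fixing `A` and `A*` exists and is
unique; the conjunct on `σ'` says that the duality is the only automorphism of `End(V)` that
swaps `A` and `A*`. -/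
theorem theorem8p2 {F V : Type*} [Field F] [AddCommGroup V] [Module F V]
    [FiniteDimensional F V] [Nontrivial V] {d : ℕ}
    (Φ : Leonard.LeonardSystem F V d) (hΦ : Φ.IsSelfDual) :
    ∃ dag : Module.End F V ≃ₗ[F] Module.End F V,
      Φ.IsDagger dag ∧
      (∀ dag' : Module.End F V ≃ₗ[F] Module.End F V, Φ.IsDagger dag' → dag' = dag) ∧
      Φ.T = Φ.dual.T ∧
      Φ.T = dag Φ.T ∧
      Φ.T = dag Φ.dual.T ∧
      ∃ σ : Module.End F V ≃ₐ[F] Module.End F V,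
        Φ.IsDuality σ ∧
        (∀ σ' : Module.End F V ≃ₐ[F] Module.End F V,
          σ' Φ.A = Φ.Astar → σ' Φ.Astar = Φ.A → σ' = σ) ∧
        Leonard.Gives Φ.T σ := by
  obtain ⟨σ, hσ⟩ := hΦ
  obtain ⟨ξ, hξ⟩ := Φ.exists_isDagger
  have hT := hσ.T_eq_dual_T
  have hTξ := hσ.T_eq_dagger_T hξ
  refine ⟨ξ, hξ, fun ξ' hξ' => Φ.isDagger_unique hξ hξ', hT, hTξ, hT ▸ hTξ, σ,
    ⟨hσ, ⟨hσ.map_Astar, hσ.map_Estar, hσ.map_A, hσ.map_E⟩⟩, fun σ' hA hAs => ?_, ?_⟩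
  -- `σ⁻¹σ'` fixes `A` and `A*`, hence is the identity.
  · have h := Φ.algEquiv_eq_refl (f := σ'.trans σ.symm)
      (by rw [AlgEquiv.trans_apply, hA, σ.symm_apply_eq]; exact hσ.map_A.symm)
      (by rw [AlgEquiv.trans_apply, hAs, σ.symm_apply_eq]; exact hσ.map_Astar.symm)
    refine AlgEquiv.ext fun X => (σ.symm_apply_eq).1 ?_
    exact congrArg (fun g : Module.End F V ≃ₐ[F] Module.End F V => g X) h
  · obtain ⟨S, hTS, hST, hS⟩ := hσ.exists_eq_T_mul_mul
    exact ⟨LinearEquiv.ofLinearMap Φ.T S hTS hST, rfl, fun X => hS X⟩
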